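/- Every topological space carries its specialization preorder, $x\le y$ iff $x\in\overline{\{y\}}$; write $\mathord{\uparrow}x=\{y\mid x\le y\}$. A $T_0$ space $Y$ is a strong $d$-space if for every directed (in particular nonempty) subset $D\subseteq Y$, every $x\in Y$ and every open $U\subseteq Y$, the inclusion $\bigcap_{d\in D}\mathord{\uparrow}d\cap\mathord{\uparrow}x\subseteq U$ implies $\mathord{\uparrow}d\cap\mathord{\uparrow}x\subseteq U$ for some $d\in D$. A strong $d$-reflection of a $T_0$ space $X$ is a pair $\langle\widehat X,\mu\rangle$ of a strong $d$-space $\widehat X$ and a continuous map $\mu:X\to\widehat X$ such that for every continuous map $f:X\to Y$ to a strong $d$-space $Y$ there is a unique continuous map $f^*:\widehat X\to Y$ with $f^*\circ\mu=f$. Let $\mathbb N=\{1,2,3,\dots\}$ and let $Q=\mathbb N\cup\{a_n\mid n\in\mathbb N\}\cup\{\omega,a\}$ (all the listed elements being distinct), partially ordered by: $x\le y$ iff $x=y$; or $x,y\in\mathbb N$ and $x\le y$ in $\mathbb N$; or $x\in\mathbb N$ and $y=\omega$; or $x=a$ and $y=a_n$ for some $n\in\mathbb N$; or $x\in\mathbb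 N$ and $y=a_n$ for some $n\ge x$. Let $\sigma(Q)$ be the Scott topology of this poset, that is, the set of all upper sets $U$ such that every directed $D\subseteq Q$ with a supremum $\bigvee D\in U$ meets $U$, and let $$\tau_Q=\{U\in\sigma(Q)\mid \{a_n\mid n\in\mathbb N\}\setminus U\text{ is finite}\}\cup\{\emptyset\}.$$ **Theorem.** The space $(Q,\tau_Q)$ is a $T_0$ space, and it has no strong $d$-reflection. In particular, there exists a $T_0$ space admitting no strong $d$-reflection. -/

import Mathlib

universe u v

/-- The principal filter `↑x = {y | x ≤ y}` of a point in the specialization order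
`x ≤ y ↔ x ∈ closure {y}`. -/
def specUp {X : Type u} [TopologicalSpace X] (x : X) : Set X :=
  {y | x ∈ closure {y}}

/-- Directed sets in the specialization order: nonempty, and any two elements have an upper
bound in the set. -/
def SpecDirected {X : Type u} [TopologicalSpace X] (D : Set X) : Prop :=
  D.Nonempty ∧ DirectedOn (fun x y : X => y ∈ specUp x) D

/-- Strong `d`-spaces. -/
structure StrongDSpace (X : Type u) [TopologicalSpace X] : Prop where
  t0 : T0Space X
  exists_subset : ∀ D : Set X, SpecDirected D → ∀ (x : X) (U : Set X), IsOpen U →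
    (⋂ d ∈ D, specUp d) ∩ specUp x ⊆ U → ∃ d ∈ D, specUp d ∩ specUp x ⊆ U

/-- The pair `(R, μ)` is a strong `d`-reflection of `X`. The target spaces `Y` range over the
universe of `R`. -/
structure IsStrongDReflection {X : Type u} {R : Type v} [TopologicalSpace X]
    [TopologicalSpace R] (μ : C(X, R)) : Prop where
  strongD : StrongDSpace R
  existsUnique_lift : ∀ (Y : Type v) [TopologicalSpace Y], StrongDSpace Y →
    ∀ f : C(X, Y), ∃! g : C(R, Y), g.comp μ = f

/-- The underlying set `ℕ ∪ {aₙ | n ∈ ℕ} ∪ {ω, a}` of `Q`, where `ℕ = {1, 2, 3, …}`. -/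
inductive QSpace : Type
  | nat (n : ℕ+) : QSpace
  | top (n : ℕ+) : QSpace
  | omega : QSpace
  | bot : QSpace

namespace QSpace

/-- The order of `Q`; `nat n`, `top n`, `omega`, `bot` stand for `n`, `aₙ`, `ω`, `a`. -/
inductive LeRel : QSpace → QSpace → Prop
  | refl (x : QSpace) : LeRel x x
  | nat_nat {m n : ℕ+} (h : m ≤ n) : LeRel (nat m) (nat n)
  | nat_omega (m : ℕ+) : LeRel (nat m) omega
  | bot_top (n : ℕ+) : LeRel bot (top n)
  | nat_top {m n : ℕ+} (h : m ≤ n) : LeRel (nat m) (top n)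

instance : PartialOrder QSpace where
  le := LeRel
  le_refl := LeRel.refl
  le_trans := by
    intro x y z h1 h2
    cases h1 with
    | refl => exact h2
    | nat_nat h =>
      cases h2 with
      | refl => exact .nat_nat h
      | nat_nat h' => exact .nat_nat (h.trans h')
      | nat_omega => exact .nat_omega _
      | nat_top h' => exact .nat_top (h.trans h')
    | nat_omega => cases h2; exact .nat_omega _
    | bot_top => cases h2; exact .bot_top _
    | nat_top h => cases h2; exact .nat_top h
  le_antisymm := by
    intro x y h1 h2
    cases h1 with
    | nat_nat h =>
      cases h2 with
      | refl => rfl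
      | nat_nat h' => rw [le_antisymm h h']
    | refl => rfl
    | _ => cases h2

/-- The nonempty open sets are the Scott open sets containing all but finitely many `aₙ`. -/
instance : TopologicalSpace QSpace where
  IsOpen U := ((Topology.scott QSpace Set.univ).IsOpen U ∧ (Set.range top \ U).Finite) ∨ U = ∅
  isOpen_univ := Or.inl ⟨@isOpen_univ _ (Topology.scott QSpace Set.univ), by simp⟩
  isOpen_inter := by
    rintro s t (⟨hs, hs'⟩ | rfl) (⟨ht, ht'⟩ | rfl)
    · refine Or.inl ⟨@IsOpen.inter _ (Topology.scott QSpace Set.univ) _ _ hs ht, ?_⟩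
      rw [Set.sdiff_inter]
      exact hs'.union ht'
    all_goals simp
  isOpen_sUnion := by
    intro S hS
    by_cases h : ∃ U ∈ S, U ≠ ∅
    · obtain ⟨U, hU, hne⟩ := h
      refine Or.inl ⟨@isOpen_sUnion _ (Topology.scott QSpace Set.univ) _ fun V hV => ?_, ?_⟩
      · rcases hS V hV with h | rfl
        · exact h.1
        · exact @isOpen_empty _ (Topology.scott QSpace Set.univ)
      · exact ((hS U hU).resolve_right hne).2.subset
          (Set.sdiff_subset_sdiff_right (Set.subset_sUnion_of_mem hU))
    · push Not at h
      exact Or.inr (Set.sUnion_eq_empty.2 h)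

end QSpace

/-! ### Order and topology of `Q`. -/

namespace QSpace

/-! In `Q` the chain `ℕ` and the point `a` have no common upper bound, yet `aₙ` lies above both `n`
and `a`. Hence a continuous image of `Q` in a strong `d`-space must acquire a bound `p`
(`StrongDSpace.exists_upper_bound`, the defining property with `U = ∅`). Such a bound can be added
in two symmetric ways at once: `PeakedQSpace` is a strong `d`-space (`strongDSpace`) where the
bounds of `ℕ ∪ {a}` are exactly two peaks, exchanged by a homeomorphism fixing `Q`. If a reflection
existed, the lift `g` of the inclusion would be unique, hence invariant under the exchange; but `g
p` is a peak, and no peak is fixed. -/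

@[simp] lemma nat_le_nat {m n : ℕ+} : nat m ≤ nat n ↔ m ≤ n := by
  refine ⟨fun h => ?_, LeRel.nat_nat⟩
  cases h with
  | refl => exact le_rfl
  | nat_nat h => exact h

@[simp] lemma nat_le_top {m n : ℕ+} : nat m ≤ top n ↔ m ≤ n :=
  ⟨fun h => by cases h; assumption, LeRel.nat_top⟩

@[simp] lemma nat_le_omega (m : ℕ+) : nat m ≤ omega := LeRel.nat_omega m

@[simp] lemma bot_le_top (n : ℕ+) : bot ≤ top n := LeRel.bot_top n

@[simp] lemma not_nat_le_bot (m : ℕ+) : ¬ nat m ≤ bot := nofun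

@[simp] lemma not_bot_le_nat (m : ℕ+) : ¬ bot ≤ nat m := nofun

@[simp] lemma not_bot_le_omega : ¬ bot ≤ omega := nofun

@[simp] lemma omega_le_iff {x : QSpace} : omega ≤ x ↔ x = omega :=
  ⟨fun h => by cases h; rfl, fun h => h ▸ le_rfl⟩

@[simp] lemma top_le_iff {n : ℕ+} {x : QSpace} : top n ≤ x ↔ x = top n :=
  ⟨fun h => by cases h; rfl, fun h => h ▸ le_rfl⟩

/-- The only directed sets that do not contain their supremum are unbounded sets of natural
numbers, with supremum `omega`. -/
lemma dirSupInacc_iff {U : Set QSpace} (hU : IsUpperSet U) :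
    DirSupInacc U ↔ (omega ∈ U → ∃ n, nat n ∈ U) := by
  constructor
  · intro h hω
    obtain ⟨_, ⟨n, rfl⟩, hn⟩ := h (d := Set.range nat) (Set.range_nonempty _)
      (by
        rintro _ ⟨m, rfl⟩ _ ⟨n, rfl⟩
        exact ⟨nat (max m n), ⟨_, rfl⟩, by simp, by simp⟩)
      (a := omega)
      ⟨by rintro _ ⟨m, rfl⟩; simp, fun b hb => by
        have hb' : ∀ n, nat n ≤ b := fun n => hb ⟨n, rfl⟩
        cases b with
        | nat m => exact absurd (nat_le_nat.1 (hb' (m + 1))) (not_le.2 (PNat.lt_add_right m 1))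
        | top m => exact absurd (nat_le_top.1 (hb' (m + 1))) (not_le.2 (PNat.lt_add_right m 1))
        | omega => exact le_rfl
        | bot => exact absurd (hb' 1) (not_nat_le_bot 1)⟩ hω
    exact ⟨n, hn⟩
  · intro h D hne hdir x hx hxU
    by_cases hxD : x ∈ D
    · exact ⟨x, hxD, hxU⟩
    have key : ∀ y ∈ D, y ≤ x ∧ y ≠ x := fun y hy => ⟨hx.1 hy, fun e => hxD (e ▸ hy)⟩
    cases x with
    | omega =>
      obtain ⟨n, hn⟩ := h hxU
      by_contra hc
      have hb : nat n ∈ upperBounds D := by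
        intro y hy
        obtain ⟨h1, h2⟩ := key y hy
        cases y with
        | nat m =>
          refine nat_le_nat.2 (le_of_not_ge fun hnm => hc ⟨nat m, hy, ?_⟩)
          exact hU (nat_le_nat.2 hnm) hn
        | omega => exact absurd rfl h2
        | bot => simp at h1
        | top m => simp at h1
      simpa using hx.2 hb
    | bot =>
      obtain ⟨y, hy⟩ := hne
      obtain ⟨h1, h2⟩ := key y hy
      clear key
      cases y <;> simp_all
    | nat m =>
      have hlt : ∀ y ∈ D, ∃ k, y = nat k ∧ k < m := by
        intro y hy
        obtain ⟨h1, h2⟩ := key y hy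
        clear key
        cases y with
        | nat k =>
          exact ⟨k, rfl, lt_of_le_of_ne (nat_le_nat.1 h1) fun e => h2 (e ▸ rfl)⟩
        | _ => simp_all
      have hm : m ≠ 1 := by
        rintro rfl
        obtain ⟨y, hy⟩ := hne
        obtain ⟨k, -, hk⟩ := hlt y hy
        exact (one_le (a := k)).not_gt hk
      obtain ⟨k, rfl⟩ := PNat.exists_eq_succ_of_ne_one hm
      have hb : nat k ∈ upperBounds D := by
        intro y hy
        obtain ⟨j, rfl, hj⟩ := hlt y hy
        exact nat_le_nat.2 (PNat.lt_add_one_iff.1 hj)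
      exact absurd (nat_le_nat.1 (hx.2 hb)) (not_le.2 (PNat.lt_add_right k 1))
    | top m =>
      -- Strictly below `aₘ` only `a` itself lies above `a`, so directedness gives `D = {a}` if `a ∈
      -- D`; otherwise `D` consists of naturals at most `m`.
      by_cases hbot : bot ∈ D
      · have hb : bot ∈ upperBounds D := by
          intro y hy
          obtain ⟨z, hz, hz1, hz2⟩ := hdir bot hbot y hy
          obtain ⟨h1, h2⟩ := key z hz
          clear key
          cases z <;> simp_all
        simpa using hx.2 hb
      · have hb : nat m ∈ upperBounds D := by
          intro y hy
          obtain ⟨h1, h2⟩ := key y hy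
          clear key
          cases y <;> simp_all
        simpa using hx.2 hb

lemma isOpen_iff {U : Set QSpace} (hne : U.Nonempty) :
    IsOpen U ↔ IsUpperSet U ∧ (omega ∈ U → ∃ n, nat n ∈ U) ∧ ∃ k, ∀ m ≥ k, top m ∈ U := by
  have hfin : (Set.range top \ U).Finite ↔ ∃ k, ∀ m ≥ k, top m ∈ U := by
    have himg : Set.range top \ U = top '' {m | top m ∉ U} := by
      ext x
      constructor
      · rintro ⟨⟨m, rfl⟩, hm⟩
        exact ⟨m, hm, rfl⟩
      · rintro ⟨m, hm, rfl⟩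
        exact ⟨⟨m, rfl⟩, hm⟩
    rw [himg, Set.finite_image_iff fun _ _ _ _ h => top.inj h]
    constructor
    · intro h
      obtain ⟨k, hk⟩ := h.bddAbove
      refine ⟨k + 1, fun m hm => ?_⟩
      by_contra hmU
      exact absurd ((hm.trans (hk hmU) : k + 1 ≤ k)) (not_le.2 (PNat.lt_add_right k 1))
    · rintro ⟨k, hk⟩
      exact (Set.finite_Iio k).subset fun m hm => lt_of_not_ge fun h => hm (hk m h)
  have hscott := @Topology.IsScott.isOpen_iff_isUpperSet_and_dirSupInaccOn QSpace Set.univ _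
    (Topology.scott QSpace Set.univ) U
    (@Topology.IsScott.mk QSpace Set.univ _ (Topology.scott QSpace Set.univ) rfl)
  rw [dirSupInaccOn_univ] at hscott
  change ((Topology.scott QSpace Set.univ).IsOpen U ∧ _) ∨ U = ∅ ↔ _
  rw [or_iff_left hne.ne_empty, hfin, ← and_assoc]
  refine and_congr_left fun _ => hscott.trans (and_congr_right dirSupInacc_iff)

/-- Both sets contain almost all `aₙ`. This makes neighbourhoods of a peak stable under
intersection. -/
lemma isOpen_inter_nonempty {U V : Set QSpace} (hU : IsOpen U) (hV : IsOpen V)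
    (hU' : U.Nonempty) (hV' : V.Nonempty) : (U ∩ V).Nonempty := by
  obtain ⟨-, -, k, hk⟩ := (isOpen_iff hU').1 hU
  obtain ⟨-, -, l, hl⟩ := (isOpen_iff hV').1 hV
  exact ⟨top (max k l), hk _ (le_max_left _ _), hl _ (le_max_right _ _)⟩

end QSpace

/-! ### The space with two peaks and its specialization order. -/

/-- The space `Q` together with two incomparable points above `ω` and `a`. -/
inductive PeakedQSpace : Type u
  | base (x : QSpace) : PeakedQSpace
  | peak (b : Bool) : PeakedQSpace

namespace PeakedQSpace

open QSpace

/-- A neighbourhood of a peak need only have nonempty open trace on `Q`, which already forces almost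
all `aₙ` into it. The last condition puts both peaks above every point of `Q` other than the `aₙ`.
-/
instance : TopologicalSpace PeakedQSpace.{u} where
  IsOpen V := IsOpen (base ⁻¹' V) ∧ (∀ b, peak b ∈ V → (base ⁻¹' V).Nonempty) ∧
    ∀ x, (∀ n, x ≠ top n) → base x ∈ V → ∀ b, peak b ∈ V
  isOpen_univ := ⟨isOpen_univ, fun _ _ => ⟨bot, trivial⟩, fun _ _ _ _ => trivial⟩
  isOpen_inter := by
    rintro s t ⟨hs1, hs2, hs3⟩ ⟨ht1, ht2, ht3⟩
    exact ⟨hs1.inter ht1,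
      fun b hb => isOpen_inter_nonempty hs1 ht1 (hs2 b hb.1) (ht2 b hb.2),
      fun x hx h b => ⟨hs3 x hx h.1 b, ht3 x hx h.2 b⟩⟩
  isOpen_sUnion := by
    intro S hS
    refine ⟨?_, ?_, ?_⟩
    · rw [Set.preimage_sUnion]
      exact isOpen_biUnion fun t ht => (hS t ht).1
    · rintro b ⟨t, ht, hb⟩
      exact ((hS t ht).2.1 b hb).mono (Set.preimage_mono (Set.subset_sUnion_of_mem ht))
    · rintro x hx ⟨t, ht, h⟩ b
      exact ⟨t, ht, (hS t ht).2.2 x hx h b⟩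

lemma isOpen_def {V : Set PeakedQSpace.{u}} :
    IsOpen V ↔ IsOpen (base ⁻¹' V) ∧ (∀ b, peak b ∈ V → (base ⁻¹' V).Nonempty) ∧
      ∀ x, (∀ n, x ≠ top n) → base x ∈ V → ∀ b, peak b ∈ V := Iff.rfl

lemma continuous_base : Continuous base.{u} := ⟨fun _ h => h.1⟩

/-- The order that turns out to be the specialization order. -/
def Le : PeakedQSpace.{u} → PeakedQSpace.{u} → Prop
  | base x, base y => x ≤ y
  | base x, peak _ => ∀ n, x ≠ top n
  | peak _, base _ => False
  | peak b, peak c => b = c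

lemma Le.antisymm {x y : PeakedQSpace.{u}} (h : Le x y) (h' : Le y x) : x = y := by
  cases x <;> cases y <;> simp only [Le] at h h'
  · rw [le_antisymm h h']
  · rw [h]

lemma isOpen_setOf_not_le (y : PeakedQSpace.{u}) : IsOpen {x | ¬ Le x y} := by
  have hne : (base ⁻¹' {x | ¬ Le x y}).Nonempty ∧ ∃ k, ∀ m ≥ k, ¬ Le (base (top m)) y := by
    have : ∃ k, ∀ m ≥ k, ¬ Le (base (top m)) y := by
      cases y with
      | peak b => exact ⟨1, fun m _ h => h m rfl⟩
      | base y =>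
        cases y with
        | top n =>
          refine ⟨n + 1, fun m hm h => ?_⟩
          cases top_le_iff.1 h
          exact absurd hm (not_le.2 (PNat.lt_add_right n 1))
        | _ => exact ⟨1, fun m _ h => by simp [Le] at h⟩
    exact ⟨⟨top this.choose, this.choose_spec _ le_rfl⟩, this⟩
  refine isOpen_def.2 ⟨(isOpen_iff hne.1).2 ⟨?_, ?_, hne.2⟩, fun _ _ => hne.1, ?_⟩
  · intro a b hab ha hb
    apply ha
    cases y with
    | base y => exact hab.trans hb
    | peak c =>
      rintro n rfl
      cases top_le_iff.1 hab
      exact hb n rfl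
  · intro h
    cases y with
    | base y =>
      cases y with
      | nat m => exact ⟨m + 1, fun h' => (PNat.lt_add_right m 1).not_ge (nat_le_nat.1 h')⟩
      | top m => exact ⟨m + 1, fun h' => (PNat.lt_add_right m 1).not_ge (nat_le_top.1 h')⟩
      | omega => exact absurd (le_refl omega) h
      | bot => exact ⟨1, not_nat_le_bot 1⟩
    | peak c => exact absurd (fun n => nofun) h
  · intro x hx h b hb
    cases y with
    | base y => exact hb
    | peak c => exact h hx

lemma mem_of_le {V : Set PeakedQSpace.{u}} (hV : IsOpen V) {x y : PeakedQSpace.{u}}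
    (h : Le x y) (hx : x ∈ V) : y ∈ V := by
  cases x with
  | base x =>
    cases y with
    | base y => exact ((isOpen_iff ⟨x, hx⟩).1 hV.1).1 h hx
    | peak b => exact hV.2.2 x h hx b
  | peak b =>
    cases y with
    | base y => exact h.elim
    | peak c => cases (h : b = c); exact hx

lemma mem_specUp {x y : PeakedQSpace.{u}} : y ∈ specUp x ↔ Le x y := by
  change x ∈ closure {y} ↔ _
  rw [← specializes_iff_mem_closure, specializes_iff_forall_open]
  refine ⟨fun h => ?_, fun h s hs hx => mem_of_le hs h hx⟩
  by_contra hc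
  refine h _ (isOpen_setOf_not_le y) hc ?_
  cases y with
  | base y => exact le_refl y
  | peak b => exact (rfl : b = b)

instance : T0Space PeakedQSpace.{u} := by
  rw [t0Space_iff_or_notMem_closure]
  intro x y hne
  by_contra hc
  push Not at hc
  exact hne (Le.antisymm (mem_specUp.1 hc.1) (mem_specUp.1 hc.2))

/-! ### The strong `d`-property of the peaked space. -/

/-- A directed set without a greatest element is an unbounded set of natural numbers. -/
lemma exists_nat_mem_of_directed {D : Set PeakedQSpace.{u}} (hD : SpecDirected D)
    (hmax : ¬ ∃ d ∈ D, ∀ e ∈ D, Le e d) :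
    (∀ d ∈ D, ∃ n, d = base (nat n)) ∧ ∀ k : ℕ+, ∃ n ≥ k, base (nat n) ∈ D := by
  obtain ⟨hne, hdir⟩ := hD
  -- A maximal element of a directed set is greatest.
  have hup : ∀ d ∈ D, ∃ e ∈ D, Le d e ∧ e ≠ d := by
    intro d hd
    by_contra hc
    push Not at hc
    refine hmax ⟨d, hd, fun e he => ?_⟩
    obtain ⟨z, hz, hdz, hez⟩ := hdir d hd e he
    have hzd := hc z hz (mem_specUp.1 hdz)
    exact hzd ▸ mem_specUp.1 hez
  have hpeak : ∀ b, peak b ∉ D := by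
    intro b hb
    obtain ⟨e, -, hle, hne⟩ := hup _ hb
    cases e with
    | base y => exact hle
    | peak c => exact hne (by rw [show b = c from hle])
  have htop : ∀ n, base (top n) ∉ D := by
    intro n hn
    obtain ⟨e, -, hle, hne⟩ := hup _ hn
    cases e with
    | base y => exact hne (by rw [top_le_iff.1 hle])
    | peak c => exact hle n rfl
  have homega : base omega ∉ D := by
    intro h
    obtain ⟨e, he, hle, hne⟩ := hup _ h
    cases e with
    | base y => exact hne (by rw [omega_le_iff.1 hle])
    | peak c => exact hpeak c he
  have hbot : base bot ∉ D := by
    intro h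
    obtain ⟨e, he, hle, hne⟩ := hup _ h
    cases e with
    | base y =>
      cases y with
      | top n => exact htop n he
      | bot => exact hne rfl
      | omega => exact homega he
      | nat n => exact not_bot_le_nat n hle
    | peak c => exact hpeak c he
  have hnat : ∀ d ∈ D, ∃ n, d = base (nat n) := by
    intro d hd
    cases d with
    | peak b => exact absurd hd (hpeak b)
    | base y =>
      cases y with
      | nat n => exact ⟨n, rfl⟩
      | top n => exact absurd hd (htop n)
      | omega => exact absurd hd homega
      | bot => exact absurd hd hbot
  refine ⟨hnat, fun k => ?_⟩
  induction k using PNat.recOn with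
  | one =>
    obtain ⟨d, hd⟩ := hne
    obtain ⟨n, rfl⟩ := hnat d hd
    exact ⟨n, one_le, hd⟩
  | succ k ih =>
    obtain ⟨n, hkn, hn⟩ := ih
    obtain ⟨e, he, hle, hne⟩ := hup _ hn
    obtain ⟨m, rfl⟩ := hnat e he
    refine ⟨m, ?_, he⟩
    have hnm : n < m := lt_of_le_of_ne (nat_le_nat.1 hle) fun h => hne (h ▸ rfl)
    exact PNat.add_one_le_iff.2 (lt_of_le_of_lt hkn hnm)

lemma strongDSpace : StrongDSpace PeakedQSpace.{u} where
  t0 := inferInstance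
  exists_subset := by
    intro D hD x U hU hsub
    by_cases hmax : ∃ d ∈ D, ∀ e ∈ D, Le e d
    · obtain ⟨d, hd, hde⟩ := hmax
      refine ⟨d, hd, fun y hy => hsub ⟨Set.mem_iInter₂.2 fun e he => ?_, hy.2⟩⟩
      exact specializes_iff_mem_closure.1
        ((specializes_iff_mem_closure.2 hy.1).trans
          (specializes_iff_mem_closure.2 (mem_specUp.2 (hde e he))))
    obtain ⟨hnat, hunb⟩ := exists_nat_mem_of_directed hD hmax
    have hmem : ∀ y, (∀ n, Le (base (nat n)) y) → Le x y → y ∈ U := by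
      refine fun y hy hxy => hsub ⟨Set.mem_iInter₂.2 fun e he => ?_, mem_specUp.2 hxy⟩
      obtain ⟨n, rfl⟩ := hnat e he
      exact mem_specUp.2 (hy n)
    suffices h : ∃ k : ℕ+, ∀ n ≥ k, ∀ y, Le (base (nat n)) y → Le x y → y ∈ U by
      obtain ⟨k, hk⟩ := h
      obtain ⟨n, hkn, hn⟩ := hunb k
      exact ⟨_, hn, fun y hy => hk n hkn y (mem_specUp.1 hy.1) (mem_specUp.1 hy.2)⟩
    have hpeak : ∀ b, Le x (peak b) → peak b ∈ U := fun b => hmem _ fun n m => nofun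
    cases x with
    | peak b =>
      refine ⟨1, fun n _ y _ hy => ?_⟩
      cases y with
      | base y => exact hy.elim
      | peak c => exact hpeak c hy
    | base x =>
      cases x with
      | top m =>
        -- Past `m`, the point `aₘ` is no longer above `n`.
        refine ⟨m + 1, fun n hn y hny hy => ?_⟩
        cases y with
        | base y =>
          cases top_le_iff.1 hy
          exact absurd (hn.trans (nat_le_top.1 hny) : m + 1 ≤ m)
            (not_le.2 (PNat.lt_add_right m 1))
        | peak c => exact hpeak c hy
      | omega =>
        refine ⟨1, fun n _ y _ hy => ?_⟩
        cases y with
        | base y =>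
          cases omega_le_iff.1 hy
          exact hmem _ (fun n => nat_le_omega n) hy
        | peak c => exact hpeak c hy
      | bot =>
        -- The decisive case: `U` contains the peaks, hence almost all `aₘ`, and only these and the
        -- peaks lie above both `a` and a large `n`.
        have hne := hU.2.1 true (hpeak true fun n => nofun)
        obtain ⟨-, -, k, hk⟩ := (isOpen_iff hne).1 hU.1
        refine ⟨k, fun n hn y hny hy => ?_⟩
        cases y with
        | base y =>
          cases y with
          | top m => exact hk m (hn.trans (nat_le_top.1 hny))
          | bot => exact absurd hny (not_nat_le_bot n)
          | omega => exact absurd hy not_bot_le_omega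
          | nat m => exact absurd hy (not_bot_le_nat m)
        | peak c => exact hpeak c hy
      | nat m =>
        have hω : base omega ∈ U := hmem _ (fun n => nat_le_omega n) (nat_le_omega m)
        obtain ⟨-, hscott, -⟩ := (isOpen_iff ⟨omega, hω⟩).1 hU.1
        obtain ⟨k, hk⟩ := hscott hω
        refine ⟨k, fun n hn y hny _ => mem_of_le hU hny (mem_of_le hU ?_ hk)⟩
        exact nat_le_nat.2 hn

/-- The map exchanging the two peaks. -/
def swap : PeakedQSpace.{u} → PeakedQSpace.{u}
  | base x => base x
  | peak b => peak (!b)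

lemma continuous_swap : Continuous swap.{u} :=
  ⟨fun _ hV => ⟨hV.1, fun b hb => hV.2.1 (!b) hb, fun x hx h b => hV.2.2 x hx h (!b)⟩⟩

lemma exists_eq_peak {y : PeakedQSpace.{u}} (hnat : ∀ n, Le (base (nat n)) y)
    (hbot : Le (base bot) y) : ∃ b, y = peak b := by
  cases y with
  | peak b => exact ⟨b, rfl⟩
  | base y =>
    cases y with
    | nat m => exact absurd hbot (not_bot_le_nat m)
    | omega => exact absurd hbot not_bot_le_omega
    | bot => exact absurd (hnat 1) (not_nat_le_bot 1)
    | top m =>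
      exact absurd (nat_le_top.1 (hnat (m + 1))) (not_le.2 (PNat.lt_add_right m 1))

end PeakedQSpace

/-! ### Forced upper bounds and the contradiction. -/

lemma map_mem_specUp {X : Type u} {Y : Type v} [TopologicalSpace X] [TopologicalSpace Y]
    {f : X → Y} (hf : Continuous f) {x y : X} (h : y ∈ specUp x) : f y ∈ specUp (f x) :=
  specializes_iff_mem_closure.1 ((specializes_iff_mem_closure.2 h).map hf)

lemma QSpace.mem_specUp_of_le {x y : QSpace} (h : x ≤ y) : y ∈ specUp x :=
  specializes_iff_mem_closure.1 <| specializes_iff_forall_open.2 fun _ hs hx =>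
    ((QSpace.isOpen_iff ⟨x, hx⟩).1 hs).1 h hx

/-- A continuous map from `Q` to a strong `d`-space sends `ℕ ∪ {a}` to a set with an upper
bound. -/
lemma StrongDSpace.exists_upper_bound {R : Type u} [TopologicalSpace R] (hR : StrongDSpace R)
    {f : QSpace → R} (hf : Continuous f) :
    ∃ p, (∀ n, p ∈ specUp (f (.nat n))) ∧ p ∈ specUp (f .bot) := by
  have hdir : SpecDirected (Set.range fun n => f (.nat n)) := by
    refine ⟨Set.range_nonempty _, ?_⟩
    rintro _ ⟨m, rfl⟩ _ ⟨n, rfl⟩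
    exact ⟨_, ⟨max m n, rfl⟩, map_mem_specUp hf (QSpace.mem_specUp_of_le (by simp)),
      map_mem_specUp hf (QSpace.mem_specUp_of_le (by simp))⟩
  by_contra hc
  obtain ⟨_, ⟨n, rfl⟩, hn⟩ := hR.exists_subset _ hdir (f .bot) ∅ isOpen_empty fun p hp =>
    hc ⟨p, fun n => Set.mem_iInter₂.1 hp.1 _ ⟨n, rfl⟩, hp.2⟩
  exact hn (a := f (.top n)) ⟨map_mem_specUp hf (QSpace.mem_specUp_of_le (by simp)),
    map_mem_specUp hf (QSpace.mem_specUp_of_le (by simp))⟩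

open PeakedQSpace in
theorem mainTheorem2 :
    T0Space QSpace ∧
      ¬ ∃ (R : Type u) (_ : TopologicalSpace R) (μ : C(QSpace, R)), IsStrongDReflection μ := by
  refine ⟨t0Space_of_injective_of_continuous
    (fun _ _ h => base.inj h) continuous_base.{0}, ?_⟩
  rintro ⟨R, _, μ, hμ⟩
  obtain ⟨p, hnat, hbot⟩ := hμ.strongD.exists_upper_bound μ.continuous
  let f : C(QSpace, PeakedQSpace.{u}) := ⟨base, continuous_base⟩
  obtain ⟨g, hg, hunique⟩ := hμ.existsUnique_lift PeakedQSpace.{u} strongDSpace f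
  have hgμ : ∀ x, g (μ x) = base x := fun x => DFunLike.congr_fun hg x
  -- `swap` fixes `Q` pointwise, so both sides lift the same map.
  have hswap : (ContinuousMap.mk swap continuous_swap).comp g = g := by
    refine hunique _ (ContinuousMap.ext fun x => ?_)
    change swap (g (μ x)) = base x
    rw [hgμ]
    rfl
  have hle : ∀ x, p ∈ specUp (μ x) → Le (base x) (g p) := fun x hx =>
    hgμ x ▸ mem_specUp.1 (map_mem_specUp g.continuous hx)
  obtain ⟨b, hb⟩ := exists_eq_peak (fun n => hle _ (hnat n)) (hle _ hbot)
  have hp : swap (g p) = g p := DFunLike.congr_fun hswap p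
  rw [hb] at hp
  exact Bool.not_ne_self b (peak.inj hp)
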